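/- Let $L\ge 1$ be odd and let $\omega_d$ denote the volume of the $d$-dimensional Euclidean unit ball. Let $(\Lambda_s)$ be a family (sequence or net) of lattices in $\mathbb{R}^L$, all geometrically similar to one fixed full-rank lattice (obtained from it by scaling and an orthogonal transformation); let $\nu_s$ be the volume of a fundamental region of $\Lambda_s$ and $\lambda_0\in\Lambda_s$. For $r\ge 0$ let $T(r)$ be the number of 3-tuples $(\lambda_0,\lambda_1,\lambda_2)$ with $\lambda_1,\lambda_2\in\Lambda_s$ all of whose pairwise Euclidean distances are at most $r$. For $N\ge 1$ let $\bar r$ be the radius of the ball in $\mathbb{R}^L$ of volume $\nu_s\sqrt N$ (the lower bound $\nu_sN^{1/(K-1)}$ for $K=3$), that is, $\bar r=(\nu_s\sqrt N/\omega_L)^{1/L}$. The dimensionless expansion factor is the high-resolution limit of $r/\bar r$, where $r$ is determined by the requirement $T(r)=N$. It exists and equals $$\psi_L=\left(\frac{\omega_L}{\omega_{L-1}}\right)^{1/2L}\left(\frac{L+1}{2L}\right)^{1/2L}\beta_L^{-1/2L},$$ where $$\beta_L=\sum_{n=0}^{\frac{L+1}2}\binom{\frac{L+1}2}{n}2^{\frac{L+1}2-n}(-1)^n\sum_{k=0}^{\frac{L-1}2}\frac{\left(\frac{L+1}2\right)_k\left(\frac{1-L}2\right)_k}{\left(\frac{L+3}2\right)_k\,k!}\sum_{j=0}^k\binom{k}{j}\left(\frac12\right)^{k-j}(-1)^j\left(\frac14\right)^j\frac{1}{L+n+j}>0,$$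 $(a)_0=1$ and $(a)_k=a(a+1)\cdots(a+k-1)$ for $k\ge1$. Precisely: (i) if radii $r$ and integers $N$ are such that $r^L/\nu_s\to\infty$ and $T(r)/N\to 1$ (in particular if $T(r)=N$), then $r/\bar r\to\psi_L$; (ii) if $N\to\infty$ and $r_N$ is the least radius $r\ge 0$ with $T(r)\ge N$, then $r_N^L/\nu_s\to\infty$, $T(r_N)/N\to1$ and $r_N/\bar r\to\psi_L$. -/

import Mathlib

open Filter Topology Asymptotics

namespace MDLVQ

/-- The Euclidean space `ℝ^L`, with the ordinary (unnormalized) Euclidean norm. -/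
abbrev Space (L : ℕ) : Type := EuclideanSpace ℝ (Fin L)

/-- `Λ'` is geometrically similar to `Λ`: it is obtained from `Λ` by a change of scale and an
orthogonal transformation (a rotation, possibly with a reflection). -/
def GeomSimilar {L : ℕ} (Λ Λ' : Submodule ℤ (Space L)) : Prop :=
  ∃ c : ℝ, 0 < c ∧ ∃ U : Space L ≃ₗᵢ[ℝ] Space L,
    (Λ' : Set (Space L)) = (fun x => c • U x) '' (Λ : Set (Space L))

/-- `ω_L`, the volume of the `L`-dimensional unit sphere (that is, of the solid unit ball). -/
noncomputable def omega (L : ℕ) : ℝ :=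
  (MeasureTheory.volume (Metric.closedBall (0 : Space L) 1)).toReal

/-- The `K`-tuples of points of `Λ` with first coordinate `l₀`, all of whose pairwise distances
are at most `r`. -/
def tuples {L : ℕ} (K : ℕ) [NeZero K] (Λ : Submodule ℤ (Space L)) (l₀ : Space L) (r : ℝ) :
    Set (Fin K → Space L) :=
  {t | (∀ i, t i ∈ Λ) ∧ t 0 = l₀ ∧ ∀ i j, dist (t i) (t j) ≤ r}

/-- The number `T` of such `K`-tuples (a finite number when `Λ` is a lattice). -/
noncomputable def numTuples {L : ℕ} (K : ℕ) [NeZero K] (Λ : Submodule ℤ (Space L))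
    (l₀ : Space L) (r : ℝ) : ℕ :=
  (tuples K Λ l₀ r).ncard

/-- The least radius for which at least `N` such `K`-tuples can be made. -/
noncomputable def leastRadius {L : ℕ} (K : ℕ) [NeZero K] (Λ : Submodule ℤ (Space L))
    (l₀ : Space L) (N : ℕ) : ℝ :=
  sInf {r : ℝ | 0 ≤ r ∧ N ≤ numTuples K Λ l₀ r}

/-- The radius `r̄` of the sphere in `ℝ^L` whose volume is the lower bound
`ν_s N^(1/(K-1))`, i.e. the volume of `N^(1/(K-1))` fundamental regions of volume `ν_s`. -/
noncomputable def lowerRadius (K L : ℕ) (νs : ℝ) (N : ℕ) : ℝ :=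
  (νs * (N : ℝ) ^ (1 / ((K : ℝ) - 1)) / omega L) ^ (1 / (L : ℝ))

/-- The factor `r / r̄` by which a sphere of radius `r` is expanded from the lower bound. -/
noncomputable def expansion {L : ℕ} (K : ℕ) (Λ : Submodule ℤ (Space L)) (N : ℕ) (r : ℝ) : ℝ :=
  r / lowerRadius K L (ZLattice.covolume Λ) N

/-- The Pochhammer symbol `(a)_k = a (a + 1) ⋯ (a + k - 1)`. -/
noncomputable def poch (a : ℝ) (k : ℕ) : ℝ := (ascPochhammer ℝ k).eval a

/-- The constant `β_L` (for odd `L`, so that the divisions by two in the ranges are exact). -/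
noncomputable def beta (L : ℕ) : ℝ :=
  ∑ n ∈ Finset.range ((L + 1) / 2 + 1),
    (((L + 1) / 2).choose n : ℝ) * 2 ^ ((L + 1) / 2 - n) * (-1) ^ n *
      ∑ k ∈ Finset.range ((L - 1) / 2 + 1),
        poch (((L : ℝ) + 1) / 2) k * poch ((1 - (L : ℝ)) / 2) k /
            (poch (((L : ℝ) + 3) / 2) k * (k.factorial : ℝ)) *
          ∑ j ∈ Finset.range (k + 1),
            (k.choose j : ℝ) * (1 / 2) ^ (k - j) * (-1) ^ j * (1 / 4) ^ j *
              (1 / ((L : ℝ) + n + j))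

/-- The closed form `(ω_L/ω_{L-1})^{1/2L} ((L+1)/(2L))^{1/2L} β_L^{-1/2L}`. -/
noncomputable def psi (L : ℕ) : ℝ :=
  (omega L / omega (L - 1)) ^ (1 / (2 * (L : ℝ))) *
    (((L : ℝ) + 1) / (2 * (L : ℝ))) ^ (1 / (2 * (L : ℝ))) *
      beta L ^ (-(1 / (2 * (L : ℝ))))

end MDLVQ

namespace MDLVQ

/-! With `λ₀` moved to the origin, a triple is a point of `Λ × Λ` in the dilate by `r` of the convex
body `unitTriples L` in dimension `2L`. Lattice point counting gives `T(r) ~ V r^(2L) / ν²`, where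
`V` is the volume of that body (`tendsto_numTuples_div_pow`). The expansion factor is a continuous
function of `N / r^(2L)`, so its limit is `(ω_L² / V)^(1/2L)`.

The volume `V` is computed by slicing: with one point fixed at distance `ρ ≤ 1` from the origin, the
other ranges over a lens of two unit balls. Its volume, integrated in polar coordinates, gives `V =
ω_L ω_{L-1} (2L/(L+1)) β_L` (`volume_unitTriples`), once `beta_eq_integral` has recognised the
triple sum as an iterated integral.

A similarity changes neither `r^L / ν` nor the count, so a single lattice suffices. For least radii,
the counting asymptotics are inverted in `tendsto_div_threshold_pow`. -/

/-! ### The closed form of `β_L` as an iterated integral -/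

theorem poch_add_two_mul (m k : ℕ) :
    poch ((m : ℝ) + 2) k * (m + 1) = poch ((m : ℝ) + 1) k * (m + 1 + k) := by
  induction k with
  | zero => simp [poch]
  | succ k ih =>
    simp only [poch, ascPochhammer_succ_eval] at ih ⊢
    push_cast
    linear_combination (m + 2 + k : ℝ) * ih

theorem poch_pos {a : ℝ} (ha : 0 < a) (k : ℕ) : 0 < poch a k := ascPochhammer_pos k a ha

theorem poch_neg_natCast (m k : ℕ) :
    poch (-(m : ℝ)) k = (-1) ^ k * (k.factorial * m.choose k) := by
  rw [poch, ascPochhammer_eval_neg_eq_descPochhammer, descPochhammer_eval_eq_descFactorial,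
    Nat.descFactorial_eq_factorial_mul_choose]
  push_cast
  ring

theorem poch_ratio (m k : ℕ) :
    poch ((m : ℝ) + 1) k * poch (-(m : ℝ)) k / (poch ((m : ℝ) + 2) k * (k.factorial : ℝ)) =
      (m + 1) / (m + 1 + k) * ((-1) ^ k * m.choose k) := by
  have h2 := poch_pos (a := (m : ℝ) + 2) (by positivity) k
  have hk : (k.factorial : ℝ) ≠ 0 := by positivity
  have hmk : (m : ℝ) + 1 + k ≠ 0 := by positivity
  rw [poch_neg_natCast]
  field_simp
  linear_combination (-(m.choose k : ℝ)) * poch_add_two_mul m k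

/-- Each `1 / (L + n + j)` is the integral of `x^(2m+n+j)` over `[0, 1]`; the sums over `n` and `j`
are then binomial expansions of powers of `2 - x` and `1/2 - x/4`. -/
theorem beta_eq_integral_sum (m : ℕ) :
    beta (2 * m + 1) = ∫ x in (0 : ℝ)..1, x ^ (2 * m) * ((2 - x) ^ (m + 1) *
      ∑ k ∈ Finset.range (m + 1), (m + 1) / (m + 1 + k) * ((-1) ^ k * (m.choose k : ℝ)) *
        (1 / 2 - x / 4) ^ k) := by
  have expand : ∀ x : ℝ, x ^ (2 * m) * ((2 - x) ^ (m + 1) *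
      ∑ k ∈ Finset.range (m + 1), (m + 1) / (m + 1 + k) * ((-1) ^ k * (m.choose k : ℝ)) *
        (1 / 2 - x / 4) ^ k) =
      ∑ n ∈ Finset.range (m + 1 + 1), ((m + 1).choose n : ℝ) * 2 ^ (m + 1 - n) * (-1) ^ n *
      ∑ k ∈ Finset.range (m + 1), (m + 1) / (m + 1 + k) * ((-1) ^ k * (m.choose k : ℝ)) *
          ∑ j ∈ Finset.range (k + 1),
            (k.choose j : ℝ) * (1 / 2) ^ (k - j) * (-1) ^ j * (1 / 4) ^ j *
              x ^ (2 * m + n + j) := by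
    intro x
    have e1 : (2 - x) ^ (m + 1) = ∑ n ∈ Finset.range (m + 1 + 1),
        ((m + 1).choose n : ℝ) * 2 ^ (m + 1 - n) * (-1) ^ n * x ^ n := by
      rw [show (2 - x) = (-1) * x + 2 by ring, add_pow]
      refine Finset.sum_congr rfl fun n _ => ?_
      rw [mul_pow]; ring
    have e2 : ∀ k : ℕ, (1 / 2 - x / 4) ^ k = ∑ j ∈ Finset.range (k + 1),
        (k.choose j : ℝ) * (1 / 2) ^ (k - j) * (-1) ^ j * (1 / 4) ^ j * x ^ j := by
      intro k
      rw [show (1 / 2 - x / 4) = (-1) * (1 / 4) * x + 1 / 2 by ring, add_pow]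
      refine Finset.sum_congr rfl fun n _ => ?_
      rw [mul_pow, mul_pow]; ring
    rw [e1, Finset.sum_mul, Finset.mul_sum]
    refine Finset.sum_congr rfl fun n _ => ?_
    rw [Finset.mul_sum, Finset.mul_sum, Finset.mul_sum]
    refine Finset.sum_congr rfl fun k _ => ?_
    rw [e2, Finset.mul_sum, Finset.mul_sum, Finset.mul_sum, Finset.mul_sum, Finset.mul_sum]
    refine Finset.sum_congr rfl fun j _ => ?_
    rw [pow_add, pow_add]; ring
  simp_rw [expand]
  rw [intervalIntegral.integral_finsetSum
    (fun _ _ => Continuous.intervalIntegrable (by fun_prop) _ _)]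
  have h1 : (2 * m + 1 + 1) / 2 = m + 1 := by omega
  have h2 : (2 * m + 1 - 1) / 2 = m := by omega
  have h3 : (((2 * m + 1 : ℕ) : ℝ) + 1) / 2 = m + 1 := by push_cast; ring
  have h4 : (1 - ((2 * m + 1 : ℕ) : ℝ)) / 2 = -m := by push_cast; ring
  have h5 : (((2 * m + 1 : ℕ) : ℝ) + 3) / 2 = m + 2 := by push_cast; ring
  rw [beta, h1, h2, h3, h4, h5]
  refine Finset.sum_congr rfl fun n _ => ?_
  rw [intervalIntegral.integral_const_mul, intervalIntegral.integral_finsetSum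
    (fun _ _ => Continuous.intervalIntegrable (by fun_prop) _ _)]
  congr 1
  refine Finset.sum_congr rfl fun k _ => ?_
  rw [intervalIntegral.integral_const_mul, intervalIntegral.integral_finsetSum
    (fun _ _ => Continuous.intervalIntegrable (by fun_prop) _ _), poch_ratio]
  congr 1
  refine Finset.sum_congr rfl fun j _ => ?_
  rw [intervalIntegral.integral_const_mul, integral_pow]
  push_cast
  simp
  left; ring

/-- With `z = (1 - t) / 2` one has `1 - t² = 4 z (1 - z)`. Expanding `(1 - z)^m` and integrating
term by term yields the antiderivative `H`, which vanishes at `t = 1`. -/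
theorem integral_one_sub_sq_pow (m : ℕ) (x : ℝ) :
    (2 * m + 2) * ∫ t in (x / 2)..1, (1 - t ^ 2) ^ m =
      (2 - x) ^ (m + 1) * ∑ k ∈ Finset.range (m + 1),
        (m + 1) / (m + 1 + k) * ((-1) ^ k * (m.choose k : ℝ)) * (1 / 2 - x / 4) ^ k := by
  let H : ℝ → ℝ := fun t => ∑ k ∈ Finset.range (m + 1),
    (-4 ^ (m + 1) * ((m + 1) / (m + 1 + k) * ((-1) ^ k * (m.choose k : ℝ)))) *
      ((1 - t) / 2) ^ (m + k + 1)
  have hH : ∀ t, HasDerivAt H ((2 * m + 2) * (1 - t ^ 2) ^ m) t := by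
    intro t
    have hz : HasDerivAt (fun t : ℝ => (1 - t) / 2) (-1 / 2) t :=
      ((hasDerivAt_id t).const_sub 1).div_const 2
    have := HasDerivAt.fun_sum (u := Finset.range (m + 1)) fun k _ =>
      (hz.fun_pow (m + k + 1)).const_mul
        (-4 ^ (m + 1) * (((m : ℝ) + 1) / (m + 1 + k) * ((-1) ^ k * (m.choose k : ℝ))))
    refine this.congr_deriv ?_
    have e : (1 - t ^ 2) ^ m = 4 ^ m * ((1 - t) / 2) ^ m * (-1 * ((1 - t) / 2) + 1) ^ m := by
      rw [← mul_pow, ← mul_pow]; congr 1; ring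
    rw [e, add_pow, Finset.mul_sum, Finset.mul_sum]
    refine Finset.sum_congr rfl fun k _ => ?_
    have : (m : ℝ) + 1 + k ≠ 0 := by positivity
    simp only [Nat.add_sub_cancel, mul_pow, one_pow]
    push_cast
    field_simp
    ring
  rw [← intervalIntegral.integral_const_mul,
    intervalIntegral.integral_eq_sub_of_hasDerivAt (fun t _ => hH t)
      (Continuous.intervalIntegrable (by fun_prop) _ _)]
  have h1 : H 1 = 0 := by simp [H]
  rw [h1, zero_sub, ← Finset.sum_neg_distrib, Finset.mul_sum]
  refine Finset.sum_congr rfl fun k _ => ?_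
  rw [show (2 - x) = 4 * ((1 - x / 2) / 2) by ring, show 1 / 2 - x / 4 = (1 - x / 2) / 2 by ring,
    mul_pow]
  ring

/-- `β_L` as an iterated integral, for `L = 2m + 1`. -/
theorem beta_eq_integral (m : ℕ) :
    beta (2 * m + 1) = (2 * m + 2) *
      ∫ x in (0 : ℝ)..1, x ^ (2 * m) * ∫ t in (x / 2)..1, (1 - t ^ 2) ^ m := by
  rw [beta_eq_integral_sum, ← intervalIntegral.integral_const_mul]
  refine intervalIntegral.integral_congr fun x _ => ?_
  rw [← integral_one_sub_sq_pow]; ring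

/-! ### The volume of the body of unit triples -/

open MeasureTheory

theorem omega_eq_measureReal (L : ℕ) :
    omega L = volume.real (Metric.closedBall (0 : Space L) 1) := rfl

theorem omega_pos (L : ℕ) : 0 < omega L :=
  ENNReal.toReal_pos (Metric.measure_closedBall_pos volume _ one_pos).ne'
    measure_closedBall_lt_top.ne

theorem volume_closedBall_eq (n : ℕ) {s : ℝ} (hs : 0 ≤ s) :
    volume (Metric.closedBall (0 : Space n) s) = ENNReal.ofReal (omega n * s ^ n) := by
  rw [Measure.addHaar_closedBall' volume _ hs, finrank_euclideanSpace_fin, mul_comm,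
    ENNReal.ofReal_mul (omega_pos n).le, omega,
    ENNReal.ofReal_toReal measure_closedBall_lt_top.ne]

/-- Splitting off the first coordinate of a point of `ℝ^(n+1)`. -/
def splitHead (n : ℕ) (y : Space (n + 1)) : ℝ × Space n :=
  (y 0, WithLp.toLp 2 fun i => y i.succ)

theorem measurePreserving_splitHead (n : ℕ) : MeasurePreserving (splitHead n) := by
  have h1 := PiLp.volume_preserving_ofLp (Fin (n + 1))
  have h2 := volume_preserving_piFinSuccAbove (fun _ : Fin (n + 1) => ℝ) 0
  have h3 := (MeasurePreserving.id (volume : Measure ℝ)).prod (PiLp.volume_preserving_toLp (Fin n))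
  exact h3.comp (h2.comp h1)

theorem norm_sq_eq_splitHead {n : ℕ} (y : Space (n + 1)) :
    ‖y‖ ^ 2 = (splitHead n y).1 ^ 2 + ‖(splitHead n y).2‖ ^ 2 := by
  simp [EuclideanSpace.norm_sq_eq, splitHead, Fin.sum_univ_succ]

/-- The profile of the intersection of two unit balls with centres at distance `ρ`. -/
theorem integral_lens_profile (m : ℕ) {ρ : ℝ} (h0 : 0 ≤ ρ) (h1 : ρ ≤ 1) :
    ∫ t in (ρ - 1)..1, (1 - max (t ^ 2) ((t - ρ) ^ 2)) ^ m =
      2 * ∫ t in (ρ / 2)..1, (1 - t ^ 2) ^ m := by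
  have hc : Continuous fun t : ℝ => (1 - max (t ^ 2) ((t - ρ) ^ 2)) ^ m := by fun_prop
  -- The maximum switches at the midplane `t = ρ / 2`, and `t ↦ ρ - t` exchanges the two halves.
  rw [← intervalIntegral.integral_add_adjacent_intervals (b := ρ / 2)
    (hc.intervalIntegrable _ _) (hc.intervalIntegrable _ _), two_mul]
  congr 1
  · rw [intervalIntegral.integral_congr (g := fun t => (1 - (ρ - t) ^ 2) ^ m),
      intervalIntegral.integral_comp_sub_left (fun t => (1 - t ^ 2) ^ m)]
    · congr 1 <;> ring
    · intro t ht
      rw [Set.uIcc_of_le (by linarith)] at ht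
      have : max (t ^ 2) ((t - ρ) ^ 2) = (ρ - t) ^ 2 := by
        rw [max_eq_right (by nlinarith [ht.2])]; ring
      simp only [this]
  · refine intervalIntegral.integral_congr fun t ht => ?_
    rw [Set.uIcc_of_le (by linarith)] at ht
    have : max (t ^ 2) ((t - ρ) ^ 2) = t ^ 2 := max_eq_left (by nlinarith [ht.1])
    simp only [this]

/-- Slices orthogonal to the axis are balls of radius `√(1 - q t)` in dimension `2m`. The even
dimension removes the root and leaves a polynomial in `q t`; this is where odd `L` enters. -/
theorem volume_lens_axis (m : ℕ) {ρ : ℝ} (h0 : 0 ≤ ρ) (h1 : ρ ≤ 1) :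
    volume {y : Space (2 * m + 1) | ‖y‖ ≤ 1 ∧ dist (EuclideanSpace.single 0 ρ) y ≤ 1} =
      ENNReal.ofReal (2 * omega (2 * m) * ∫ t in (ρ / 2)..1, (1 - t ^ 2) ^ m) := by
  let q : ℝ → ℝ := fun t => max (t ^ 2) ((t - ρ) ^ 2)
  have hq : ∀ t, q t ≤ 1 ↔ t ∈ Set.Icc (ρ - 1) 1 := by
    intro t
    simp only [q, max_le_iff, sq_le_one_iff_abs_le_one, abs_le, Set.mem_Icc]
    constructor
    · rintro ⟨⟨_, _⟩, _, _⟩; constructor <;> linarith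
    · rintro ⟨_, _⟩; refine ⟨⟨?_, ?_⟩, ?_, ?_⟩ <;> linarith
  let S : Set (ℝ × Space (2 * m)) := {p | q p.1 + ‖p.2‖ ^ 2 ≤ 1}
  have hSm : MeasurableSet S := by
    refine (isClosed_le (f := fun p : ℝ × Space (2 * m) => q p.1 + ‖p.2‖ ^ 2) ?_
      continuous_const).measurableSet
    fun_prop
  have hpre : {y : Space (2 * m + 1) | ‖y‖ ≤ 1 ∧ dist (EuclideanSpace.single 0 ρ) y ≤ 1} =
      splitHead (2 * m) ⁻¹' S := by
    ext y
    have e1 : ‖y‖ ≤ 1 ↔ ‖y‖ ^ 2 ≤ 1 := (sq_le_one_iff₀ (norm_nonneg _)).symm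
    have e2 : dist (EuclideanSpace.single 0 ρ) y ≤ 1 ↔
        ‖y - EuclideanSpace.single 0 ρ‖ ^ 2 ≤ 1 := by
      rw [dist_comm, dist_eq_norm]; exact (sq_le_one_iff₀ (norm_nonneg _)).symm
    have e3 : splitHead (2 * m) (y - EuclideanSpace.single 0 ρ) =
        ((splitHead (2 * m) y).1 - ρ, (splitHead (2 * m) y).2) := by
      simp [splitHead]
    simp only [Set.mem_ofPred_eq, Set.mem_preimage, S, q]
    rw [e1, e2, norm_sq_eq_splitHead, norm_sq_eq_splitHead, e3, max_add, max_le_iff]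
  rw [hpre, (measurePreserving_splitHead _).measure_preimage hSm.nullMeasurableSet,
    Measure.volume_eq_prod, Measure.prod_apply hSm]
  have hslice : ∀ t, volume (Prod.mk t ⁻¹' S) = (Set.Icc (ρ - 1) 1).indicator
      (fun t => ENNReal.ofReal (omega (2 * m) * (1 - q t) ^ m)) t := by
    intro t
    by_cases ht : t ∈ Set.Icc (ρ - 1) 1
    · have hqt := (hq t).2 ht
      have hb : Prod.mk t ⁻¹' S = Metric.closedBall 0 (√(1 - q t)) := by
        ext z
        simp only [S, Set.mem_preimage, Set.mem_ofPred_eq, mem_closedBall_zero_iff]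
        rw [Real.le_sqrt (norm_nonneg _) (by linarith)]
        constructor <;> intro h <;> linarith
      rw [Set.indicator_of_mem ht, hb, volume_closedBall_eq _ (Real.sqrt_nonneg _), pow_mul,
        Real.sq_sqrt (by linarith)]
    · have hb : Prod.mk t ⁻¹' S = ∅ := by
        ext z
        simp only [S, Set.mem_preimage, Set.mem_ofPred_eq, Set.mem_empty_iff_false, iff_false]
        intro h
        exact ht ((hq t).1 (by nlinarith [sq_nonneg ‖z‖]))
      rw [Set.indicator_of_notMem ht, hb, measure_empty]
  have hqc : Continuous q := by fun_prop
  simp_rw [hslice]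
  rw [lintegral_indicator measurableSet_Icc, ← ofReal_integral_eq_lintegral_ofReal]
  · rw [integral_Icc_eq_integral_Ioc, ← intervalIntegral.integral_of_le (by linarith),
      intervalIntegral.integral_const_mul, integral_lens_profile m h0 h1]
    congr 1; ring
  · exact Continuous.integrableOn_Icc (by fun_prop)
  · filter_upwards [ae_restrict_mem measurableSet_Icc] with t ht
    have := (hq t).2 ht
    exact mul_nonneg (omega_pos _).le (pow_nonneg (by linarith) _)

theorem volume_lens (m : ℕ) {x : Space (2 * m + 1)} (hx : ‖x‖ ≤ 1) :
    volume {y : Space (2 * m + 1) | ‖y‖ ≤ 1 ∧ dist x y ≤ 1} =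
      ENNReal.ofReal (2 * omega (2 * m) * ∫ t in (‖x‖ / 2)..1, (1 - t ^ 2) ^ m) := by
  let e : Space (2 * m + 1) := EuclideanSpace.single 0 ‖x‖
  have he : ‖x‖ = ‖e‖ := by simp [e]
  -- The reflection in the hyperplane orthogonal to `x - e` carries `x` to the axis; it is the
  -- identity when `x = e`.
  let U : Space (2 * m + 1) ≃ₗᵢ[ℝ] Space (2 * m + 1) := (Submodule.span ℝ {x - e})ᗮ.reflection
  have hU : U x = e := Submodule.reflection_sub he
  have hpre := U.measurePreserving.measure_preimage_emb U.toHomeomorph.measurableEmbedding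
    {y : Space (2 * m + 1) | ‖y‖ ≤ 1 ∧ dist e y ≤ 1}
  rw [← volume_lens_axis m (norm_nonneg x) hx, ← hpre]
  congr 1
  ext y
  simp [← hU]

/-- The pairs of points which together with the origin have all pairwise distances at most `1`. -/
def unitTriples (L : ℕ) : Set (Space L × Space L) :=
  {p | ‖p.1‖ ≤ 1 ∧ ‖p.2‖ ≤ 1 ∧ dist p.1 p.2 ≤ 1}

theorem isClosed_unitTriples (L : ℕ) : IsClosed (unitTriples L) :=
  (isClosed_le continuous_fst.norm continuous_const).inter
    ((isClosed_le continuous_snd.norm continuous_const).inter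
      (isClosed_le continuous_dist continuous_const))

theorem volume_unitTriples (m : ℕ) :
    volume.real (unitTriples (2 * m + 1)) =
      omega (2 * m + 1) * omega (2 * m) * (2 * (2 * m + 1) / (2 * m + 2)) *
        beta (2 * m + 1) := by
  let I : ℝ → ℝ := fun ρ => ∫ t in (ρ / 2)..1, (1 - t ^ 2) ^ m
  have hI : Continuous I := by
    have : Continuous fun x : ℝ => ∫ t in (1 : ℝ)..x, (1 - t ^ 2) ^ m :=
      intervalIntegral.continuous_primitive
        (fun a b => Continuous.intervalIntegrable (by fun_prop) a b) 1
    have h2 : I = fun ρ => -∫ t in (1 : ℝ)..(ρ / 2), (1 - t ^ 2) ^ m := by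
      funext ρ; exact intervalIntegral.integral_symm _ _
    rw [h2]
    exact (this.comp (by fun_prop : Continuous fun ρ : ℝ => ρ / 2)).neg
  have hI0 : ∀ ρ, 0 ≤ ρ → ρ ≤ 1 → 0 ≤ I ρ := fun ρ h0 h1 =>
    intervalIntegral.integral_nonneg (by linarith) fun t ht =>
      pow_nonneg (by nlinarith [ht.1, ht.2]) _
  -- The cutoff at `1` makes the slice volume a radial function on the whole space, ready for polar
  -- integration.
  let h : ℝ → ℝ := (Set.Iic 1).indicator fun ρ => 2 * omega (2 * m) * I ρ
  have hm : Measurable h := (by fun_prop : Continuous fun ρ => 2 * omega (2 * m) * I ρ).measurable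
    |>.indicator measurableSet_Iic
  have hslice : ∀ x : Space (2 * m + 1),
      volume (Prod.mk x ⁻¹' unitTriples (2 * m + 1)) = ENNReal.ofReal (h ‖x‖) := by
    intro x
    by_cases hx : ‖x‖ ≤ 1
    · rw [show h ‖x‖ = _ from Set.indicator_of_mem (Set.mem_Iic.2 hx) _, ← volume_lens m hx]
      congr 1; ext y; simp [unitTriples, hx]
    · rw [show h ‖x‖ = 0 from Set.indicator_of_notMem (by simpa using hx) _]
      have : Prod.mk x ⁻¹' unitTriples (2 * m + 1) = ∅ := by
        ext y; simp [unitTriples, hx]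
      rw [this]; simp
  have hnn : ∀ x : Space (2 * m + 1), 0 ≤ h ‖x‖ := by
    intro x
    refine Set.indicator_apply_nonneg fun hx => ?_
    exact mul_nonneg (mul_nonneg zero_le_two (omega_pos _).le) (hI0 _ (norm_nonneg _) hx)
  have key : volume.real (unitTriples (2 * m + 1)) = ∫ x : Space (2 * m + 1), h ‖x‖ := by
    rw [integral_eq_lintegral_of_nonneg_ae (Eventually.of_forall hnn)
      (hm.comp measurable_norm).aestronglyMeasurable, measureReal_def, Measure.volume_eq_prod,
      Measure.prod_apply (isClosed_unitTriples _).measurableSet]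
    simp_rw [hslice]
  have hball : volume.real (Metric.ball (0 : Space (2 * m + 1)) 1) = omega (2 * m + 1) := by
    rw [omega_eq_measureReal, measureReal_def, measureReal_def,
      Measure.addHaar_unitClosedBall_eq_addHaar_unitBall]
  have hint : ∫ y in Set.Ioi (0 : ℝ), y ^ (2 * m) • h y =
      2 * omega (2 * m) * ∫ x in (0 : ℝ)..1, x ^ (2 * m) * I x := by
    have : (fun y => y ^ (2 * m) • h y) =
        (Set.Iic 1).indicator fun y => 2 * omega (2 * m) * (y ^ (2 * m) * I y) := by
      funext y
      by_cases hy : y ≤ 1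
      · simp [h, hy]; ring
      · simp [h, hy]
    rw [this, setIntegral_indicator measurableSet_Iic, Set.Ioi_inter_Iic,
      ← intervalIntegral.integral_of_le zero_le_one, intervalIntegral.integral_const_mul]
  rw [key, integral_fun_norm_addHaar volume h, finrank_euclideanSpace_fin, hball,
    Nat.add_sub_cancel, hint, beta_eq_integral]
  have : (2 * (m : ℝ) + 2) ≠ 0 := by positivity
  simp only [nsmul_eq_mul, smul_eq_mul]
  push_cast
  field_simp
  ring

theorem volume_unitTriples_pos (L : ℕ) : 0 < volume.real (unitTriples L) := by
  have hsub : Metric.ball (0 : Space L × Space L) (1 / 2) ⊆ unitTriples L := by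
    intro p hp
    have hp' := max_lt_iff.1 (mem_ball_zero_iff.1 hp)
    refine ⟨by linarith [hp'.1], by linarith [hp'.2], ?_⟩
    rw [dist_eq_norm]
    linarith [norm_sub_le p.1 p.2, hp'.1, hp'.2]
  have hbd : unitTriples L ⊆ Metric.closedBall 0 1 := fun p hp =>
    mem_closedBall_zero_iff.2 (max_le hp.1 hp.2.1)
  exact ENNReal.toReal_pos
    ((Metric.measure_ball_pos volume _ (by norm_num)).trans_le (measure_mono hsub)).ne'
    ((measure_mono hbd).trans_lt measure_closedBall_lt_top).ne

/-! ### Product lattices and their covolume -/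

section Product

variable {E F : Type*} [NormedAddCommGroup E] [NormedSpace ℝ E]
  [NormedAddCommGroup F] [NormedSpace ℝ F]

instance discreteTopology_prod (Λ : Submodule ℤ E) (M : Submodule ℤ F) [DiscreteTopology Λ]
    [DiscreteTopology M] : DiscreteTopology (Λ.prod M) := by
  let f : Λ.prod M → Λ × M := fun p => (⟨p.1.1, p.2.1⟩, ⟨p.1.2, p.2.2⟩)
  refine DiscreteTopology.of_continuous_injective (f := f) (by fun_prop) fun p q h => ?_
  simp only [f, Prod.mk.injEq, Subtype.mk.injEq] at h
  exact Subtype.ext (Prod.ext h.1 h.2)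

instance isZLattice_prod (Λ : Submodule ℤ E) (M : Submodule ℤ F) [DiscreteTopology Λ]
    [DiscreteTopology M] [IsZLattice ℝ Λ] [IsZLattice ℝ M] : IsZLattice ℝ (Λ.prod M) where
  span_top := by
    refine eq_top_iff.2 fun p _ => ?_
    have h1 : LinearMap.inl ℝ E F p.1 ∈ Submodule.span ℝ ((Λ.prod M : Submodule ℤ (E × F)) :
        Set (E × F)) := by
      refine Submodule.span_mono ?_ (Submodule.apply_mem_span_image_of_mem_span (LinearMap.inl ℝ E F)
        (by rw [IsZLattice.span_top]; trivial : p.1 ∈ Submodule.span ℝ (Λ : Set E)))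
      rintro _ ⟨x, hx, rfl⟩
      exact ⟨hx, M.zero_mem⟩
    have h2 : LinearMap.inr ℝ E F p.2 ∈ Submodule.span ℝ ((Λ.prod M : Submodule ℤ (E × F)) :
        Set (E × F)) := by
      refine Submodule.span_mono ?_ (Submodule.apply_mem_span_image_of_mem_span (LinearMap.inr ℝ E F)
        (by rw [IsZLattice.span_top]; trivial : p.2 ∈ Submodule.span ℝ (M : Set F)))
      rintro _ ⟨x, hx, rfl⟩
      exact ⟨Λ.zero_mem, hx⟩
    simpa using add_mem h1 h2

theorem covolume_prod [FiniteDimensional ℝ E] [FiniteDimensional ℝ F] [MeasurableSpace E]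
    [BorelSpace E] [MeasurableSpace F] [BorelSpace F] (Λ : Submodule ℤ E) (M : Submodule ℤ F)
    [DiscreteTopology Λ] [DiscreteTopology M] [IsZLattice ℝ Λ] [IsZLattice ℝ M]
    (μ : Measure E) (ν : Measure F) [μ.IsAddHaarMeasure] [ν.IsAddHaarMeasure] :
    ZLattice.covolume (Λ.prod M) (μ.prod ν) = ZLattice.covolume Λ μ * ZLattice.covolume M ν := by
  let b := (Module.Free.chooseBasis ℤ Λ).ofZLatticeBasis ℝ
  let b' := (Module.Free.chooseBasis ℤ M).ofZLatticeBasis ℝ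
  have hb : Submodule.span ℤ (Set.range b) = Λ := Module.Basis.ofZLatticeBasis_span ℝ Λ _
  have hb' : Submodule.span ℤ (Set.range b') = M := Module.Basis.ofZLatticeBasis_span ℝ M _
  have hex : ∀ x, ∃! v : Λ, v +ᵥ x ∈ ZSpan.fundamentalDomain b := by
    have := ZSpan.exist_unique_vadd_mem_fundamentalDomain b
    rwa [hb] at this
  have hex' : ∀ x, ∃! v : M, v +ᵥ x ∈ ZSpan.fundamentalDomain b' := by
    have := ZSpan.exist_unique_vadd_mem_fundamentalDomain b'
    rwa [hb'] at this
  -- The product of two fundamental domains is one for the product lattice.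
  have hD : IsAddFundamentalDomain (Λ.prod M)
      (ZSpan.fundamentalDomain b ×ˢ ZSpan.fundamentalDomain b') (μ.prod ν) := by
    refine IsAddFundamentalDomain.mk' ((ZSpan.fundamentalDomain_measurableSet b).prod
      (ZSpan.fundamentalDomain_measurableSet b')).nullMeasurableSet fun p => ?_
    obtain ⟨v, hv, hv'⟩ := hex p.1
    obtain ⟨w, hw, hw'⟩ := hex' p.2
    refine ⟨⟨(v, w), v.2, w.2⟩, ⟨hv, hw⟩, ?_⟩
    rintro ⟨⟨v1, w1⟩, h1⟩ h
    have e1 := hv' ⟨v1, h1.1⟩ h.1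
    have e2 := hw' ⟨w1, h1.2⟩ h.2
    exact Subtype.ext (Prod.ext (congrArg Subtype.val e1) (congrArg Subtype.val e2))
  rw [ZLattice.covolume_eq_measure_fundamentalDomain _ _ hD,
    ZLattice.covolume_eq_measure_fundamentalDomain _ _
      (ZLattice.isAddFundamentalDomain (Module.Free.chooseBasis ℤ Λ) μ),
    ZLattice.covolume_eq_measure_fundamentalDomain _ _
      (ZLattice.isAddFundamentalDomain (Module.Free.chooseBasis ℤ M) ν), measureReal_prod_prod]

end Product

/-! ### Counting triples in one lattice -/

variable {L : ℕ}

/-- The two points of a pair and their difference. -/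
def differences (L : ℕ) :
    WithLp 2 (Space L × Space L) →ₗ[ℝ] (Space L × Space L) × Space L where
  toFun p := ((p.fst, p.snd), p.fst - p.snd)
  map_add' p q := by simp; abel
  map_smul' c p := by simp [smul_sub]

/-- The sup norm packs the three distance conditions into one norm bound on a linear image, which
makes them homogeneous and convex. -/
theorem norm_differences_le_iff (p : WithLp 2 (Space L × Space L)) (r : ℝ) :
    ‖differences L p‖ ≤ r ↔ ‖p.fst‖ ≤ r ∧ ‖p.snd‖ ≤ r ∧ dist p.fst p.snd ≤ r := by
  rw [dist_eq_norm, Prod.norm_def, Prod.norm_def, max_le_iff, max_le_iff, and_assoc]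
  rfl

theorem tuples_eq_image (Λ : Submodule ℤ (Space L)) (r : ℝ) :
    tuples 3 Λ 0 r = (fun p : WithLp 2 (Space L × Space L) => ![0, p.fst, p.snd]) ''
      ({p | ‖differences L p‖ ≤ r} ∩ {p | p.fst ∈ Λ ∧ p.snd ∈ Λ}) := by
  ext t
  constructor
  · rintro ⟨h1, h2, h3⟩
    refine ⟨WithLp.toLp 2 (t 1, t 2), ⟨?_, h1 1, h1 2⟩, ?_⟩
    · refine (norm_differences_le_iff _ r).2 ⟨?_, ?_, h3 1 2⟩
      · simpa [h2] using h3 1 0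
      · simpa [h2] using h3 2 0
    · funext i; fin_cases i <;> simp [h2]
  · rintro ⟨p, ⟨hp, hp1, hp2⟩, rfl⟩
    obtain ⟨h1, h2, h3⟩ := (norm_differences_le_iff p r).1 hp
    have h0 : 0 ≤ r := (norm_nonneg _).trans h1
    refine ⟨fun i => ?_, rfl, fun i j => ?_⟩
    · fin_cases i <;> simp [hp1, hp2]
    · fin_cases i <;> fin_cases j <;> simp [h0, h1, h2, h3, dist_comm p.snd p.fst]

theorem tendsto_numTuples_div_pow (hL : 0 < L) (Λ : Submodule ℤ (Space L)) [DiscreteTopology Λ]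
    [IsZLattice ℝ Λ] :
    Tendsto (fun r : ℝ => (numTuples 3 Λ 0 r : ℝ) / r ^ (2 * L)) atTop
      (𝓝 (volume.real (unitTriples L) / ZLattice.covolume Λ ^ 2)) := by
  let e : WithLp 2 (Space L × Space L) ≃L[ℝ] Space L × Space L := WithLp.prodContinuousLinearEquiv 2 ℝ _ _
  have he : MeasurePreserving e := WithLp.volume_preserving_ofLp (Space L) (Space L)
  let M : Submodule ℤ (WithLp 2 (Space L × Space L)) := ZLattice.comap ℝ (Λ.prod Λ) e.toLinearMap
  have hfin : Module.finrank ℝ (WithLp 2 (Space L × Space L)) = 2 * L := by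
    rw [e.toLinearEquiv.finrank_eq, Module.finrank_prod, finrank_euclideanSpace_fin]; ring
  have hM : ZLattice.covolume M = ZLattice.covolume Λ ^ 2 := by
    have : (volume : Measure (Space L × Space L)).IsAddHaarMeasure :=
      inferInstanceAs (Measure.prod volume volume).IsAddHaarMeasure
    rw [sq, ← covolume_prod Λ Λ volume volume]
    exact ZLattice.covolume_comap (Λ.prod Λ) volume volume he
  have : Nontrivial (WithLp 2 (Space L × Space L)) := Module.nontrivial_of_finrank_pos (R := ℝ) (by omega)
  let A := differences L
  have hA : Continuous A := by
    have h1 : Continuous fun p => (e p).1 := continuous_fst.comp e.continuous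
    have h2 : Continuous fun p => (e p).2 := continuous_snd.comp e.continuous
    exact (h1.prodMk h2).prodMk (h1.sub h2)
  have hset : {p : WithLp 2 (Space L × Space L) | p ∈ Set.univ ∧ ‖A p‖ ^ (2 * L) ≤ 1} = e ⁻¹' unitTriples L := by
    ext p
    simp only [Set.mem_ofPred_eq, Set.mem_univ, true_and, Set.mem_preimage]
    rw [pow_le_one_iff_of_nonneg (norm_nonneg _) (by omega)]
    exact norm_differences_le_iff p 1
  have hset' : {p : WithLp 2 (Space L × Space L) | p ∈ Set.univ ∧ ‖A p‖ ^ (2 * L) ≤ 1} = A ⁻¹' Metric.closedBall 0 1 := by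
    ext p
    simp only [Set.mem_ofPred_eq, Set.mem_univ, true_and, Set.mem_preimage, mem_closedBall_zero_iff]
    rw [pow_le_one_iff_of_nonneg (norm_nonneg _) (by omega)]
  -- The exponent `2 * L` makes the gauge homogeneous of degree equal to the dimension; the level is
  -- later set to `r ^ (2 * L)`.
  have key := ZLattice.covolume.tendsto_card_le_div' M (X := Set.univ)
    (F := fun p => ‖A p‖ ^ (2 * L)) (fun _ _ _ _ => trivial) ?_ ?_ ?_ ?_
  · rw [hset, he.measureReal_preimage (isClosed_unitTriples L).measurableSet.nullMeasurableSet,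
      hM] at key
    refine (key.comp (tendsto_pow_atTop (n := 2 * L) (by omega))).congr' ?_
    filter_upwards [eventually_ge_atTop 0] with r hr
    rw [Function.comp_apply, numTuples, tuples_eq_image, Set.ncard_image_of_injective,
      Nat.card_coe_set_eq]
    · congr 3
      ext p
      simp [pow_le_pow_iff_left₀ (norm_nonneg (A p)) hr (by omega : 2 * L ≠ 0), A]
      exact fun _ => Iff.rfl
    · intro p q h
      have h1 := congrFun h 1
      have h2 := congrFun h 2
      exact WithLp.ofLp_injective 2 (Prod.ext h1 h2)
  · intro p r hr
    rw [hfin, map_smul, norm_smul, mul_pow, Real.norm_of_nonneg hr]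
  · refine isBounded_iff_forall_norm_le.2 ⟨2, fun p hp => ?_⟩
    rw [hset] at hp
    have h3 := WithLp.prod_norm_sq_eq_of_L2 p
    have h1 : ‖p.fst‖ ≤ 1 := hp.1
    have h2 : ‖p.snd‖ ≤ 1 := hp.2.1
    nlinarith [norm_nonneg p, norm_nonneg p.fst, norm_nonneg p.snd]
  · rw [hset']
    exact (Metric.isClosed_closedBall.preimage hA).measurableSet
  · rw [hset']
    -- The boundary is null because the body is convex.
    exact ((convex_closedBall 0 1).linear_preimage A).addHaar_frontier volume

/-- Needed for monotonicity of the count, since `Set.ncard` is `0` on infinite sets. -/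
theorem finite_tuples (K : ℕ) [NeZero K] (Λ : Submodule ℤ (Space L)) [DiscreteTopology Λ]
    (r : ℝ) : (tuples K Λ 0 r).Finite := by
  have : IsClosed (Λ : Set (Space L)) := by
    have : DiscreteTopology Λ.toAddSubgroup := inferInstanceAs (DiscreteTopology Λ)
    exact AddSubgroup.isClosed_of_discrete (H := Λ.toAddSubgroup)
  have hf : (Metric.closedBall 0 r ∩ (Λ : Set (Space L))).Finite :=
    Metric.finite_isBounded_inter_isClosed ⟨‹_›⟩ Metric.isBounded_closedBall this
  refine (Set.Finite.pi' fun _ : Fin K => hf).subset fun t ht i => ⟨?_, ht.1 i⟩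
  have := ht.2.2 i 0
  rwa [ht.2.1] at this

theorem numTuples_mono (K : ℕ) [NeZero K] (Λ : Submodule ℤ (Space L)) [DiscreteTopology Λ] :
    Monotone (numTuples K Λ 0) := fun _ s hrs =>
  Set.ncard_le_ncard (fun _ ht => ⟨ht.1, ht.2.1, fun i j => (ht.2.2 i j).trans hrs⟩)
    (finite_tuples K Λ s)

/-! ### Inverting the asymptotics of a counting function -/

section StepFunctions

theorem tendsto_comp_add_div_pow {f : ℝ → ℝ} {A : ℝ} {k : ℕ}
    (hf : Tendsto (fun x => f x / x ^ k) atTop (𝓝 A)) (a : ℝ) :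
    Tendsto (fun x => f (x + a) / x ^ k) atTop (𝓝 A) := by
  have h1 : Tendsto (fun x : ℝ => (x + a) / x) atTop (𝓝 1) := by
    have : Tendsto (fun x : ℝ => 1 + a / x) atTop (𝓝 (1 + 0)) :=
      (tendsto_const_nhds.div_atTop tendsto_id).const_add 1
    rw [add_zero] at this
    refine this.congr' ?_
    filter_upwards [eventually_gt_atTop 0] with x hx
    field_simp
  have h2 := (hf.comp (tendsto_atTop_add_const_right _ a tendsto_id)).mul (h1.pow k)
  rw [one_pow, mul_one] at h2
  refine h2.congr' ?_
  filter_upwards [eventually_gt_atTop 0, eventually_gt_atTop (-a)] with x hx hx'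
  have : x + a ≠ 0 := by linarith
  simp only [Function.comp_apply, id, div_pow]
  field_simp

variable {T : ℝ → ℕ} {A : ℝ} {k : ℕ}

theorem tendsto_atTop_of_div_pow (hk : k ≠ 0) (hA : 0 < A)
    (hT : Tendsto (fun r : ℝ => (T r : ℝ) / r ^ k) atTop (𝓝 A)) : Tendsto T atTop atTop := by
  refine tendsto_natCast_atTop_iff.1 ((hT.pos_mul_atTop hA (tendsto_pow_atTop hk)).congr' ?_)
  filter_upwards [eventually_gt_atTop 0] with x hx
  field_simp

/-- The least argument at which a counting function reaches `N`. -/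
noncomputable def threshold (T : ℝ → ℕ) (N : ℕ) : ℝ := sInf {r : ℝ | 0 ≤ r ∧ N ≤ T r}

theorem threshold_set_nonempty (hT : Tendsto T atTop atTop) (N : ℕ) :
    {r : ℝ | 0 ≤ r ∧ N ≤ T r}.Nonempty :=
  ((eventually_ge_atTop (0 : ℝ)).and (hT.eventually_ge_atTop N)).exists

theorem tendsto_threshold (hm : Monotone T) (hT : Tendsto T atTop atTop) :
    Tendsto (threshold T) atTop atTop := by
  refine tendsto_atTop.2 fun M => ?_
  filter_upwards [eventually_gt_atTop (T M)] with N hN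
  refine le_csInf (threshold_set_nonempty hT N) fun r hr => ?_
  by_contra! h
  exact absurd (hr.2.trans (hm h.le)) hN.not_ge

/-- With `R` the threshold of `N`, one has `T (R - 1) ≤ N ≤ T (R + 1)`, and unit shifts do not
affect the leading term. Whether the infimum is attained is irrelevant. -/
theorem tendsto_div_threshold_pow (hm : Monotone T) (hk : k ≠ 0) (hA : 0 < A)
    (hT : Tendsto (fun r : ℝ => (T r : ℝ) / r ^ k) atTop (𝓝 A)) :
    Tendsto (fun N : ℕ => (N : ℝ) / threshold T N ^ k) atTop (𝓝 A) := by
  have hTt := tendsto_atTop_of_div_pow hk hA hT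
  have hR := tendsto_threshold hm hTt
  have hbdd : ∀ N, BddBelow {r : ℝ | 0 ≤ r ∧ N ≤ T r} := fun N => ⟨0, fun _ hr => hr.1⟩
  refine tendsto_of_tendsto_of_tendsto_of_le_of_le'
    ((tendsto_comp_add_div_pow (f := fun x => (T x : ℝ)) hT (-1)).comp hR)
    ((tendsto_comp_add_div_pow (f := fun x => (T x : ℝ)) hT 1).comp hR) ?_ ?_
  -- The bound `R ≥ 1` keeps `R - 1` among the nonnegative radii admitted in the infimum.
  · filter_upwards [hR.eventually_ge_atTop 1] with N hN
    have : T (threshold T N + -1) ≤ N := by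
      by_contra! h
      have := csInf_le (hbdd N) (a := threshold T N + -1) ⟨by linarith, h.le⟩
      change threshold T N ≤ _ at this
      linarith
    simp only [Function.comp_apply]
    gcongr
  · filter_upwards [hR.eventually_ge_atTop 1] with N hN
    have : N ≤ T (threshold T N + 1) := by
      obtain ⟨r, hr, hr'⟩ := exists_lt_of_csInf_lt (threshold_set_nonempty hTt N)
        (show sInf _ < threshold T N + 1 from lt_add_one _)
      exact hr.2.trans (hm hr'.le)
    simp only [Function.comp_apply]
    gcongr

end StepFunctions

/-- The signs in the defining sum alternate; positivity is read off from the volume formula instead.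
-/
theorem beta_pos {L : ℕ} (hL : Odd L) : 0 < beta L := by
  obtain ⟨m, rfl⟩ := hL
  have h := volume_unitTriples_pos (2 * m + 1)
  rw [volume_unitTriples] at h
  have h1 := omega_pos (2 * m + 1)
  have h2 := omega_pos (2 * m)
  exact pos_of_mul_pos_right h (by positivity)

/-! ### Reduction to a single lattice and the limit of the expansion factor -/

section Similarity

variable {L : ℕ}

theorem numTuples_similar (K : ℕ) [NeZero K] {Λ Λ' : Submodule ℤ (Space L)} {c : ℝ} (hc : 0 < c)
    (U : Space L ≃ₗᵢ[ℝ] Space L)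
    (h : (Λ' : Set (Space L)) = (fun x => c • U x) '' (Λ : Set (Space L)))
    {l₀ : Space L} (hl₀ : l₀ ∈ Λ') (r : ℝ) :
    numTuples K Λ' l₀ r = numTuples K Λ 0 (r / c) := by
  -- This affine similarity carries tuples based at the origin to tuples based at `l₀`.
  let f : (Fin K → Space L) → (Fin K → Space L) := fun t i => l₀ + c • U (t i)
  have hf : Function.Injective f := by
    intro s t hst
    funext i
    have := congrFun hst i
    simpa [f, hc.ne'] using this
  have hd : ∀ x y : Space L, dist (l₀ + c • U x) (l₀ + c • U y) ≤ r ↔ dist x y ≤ r / c := by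
    intro x y
    rw [dist_add_left, dist_smul₀, U.dist_map, Real.norm_of_nonneg hc.le, le_div_iff₀' hc]
  have hmem : ∀ x, l₀ + c • U x ∈ Λ' ↔ x ∈ Λ := by
    intro x
    rw [Submodule.add_mem_iff_right _ hl₀, ← SetLike.mem_coe, h]
    constructor
    · rintro ⟨y, hy, hyx⟩
      have : y = x := by simpa [hc.ne'] using hyx
      exact this ▸ hy
    · exact fun hx => ⟨x, hx, rfl⟩
  rw [numTuples, numTuples, ← Set.ncard_image_of_injective (tuples K Λ 0 (r / c)) hf]
  refine congrArg Set.ncard (Set.ext fun t => ?_)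
  constructor
  · rintro ⟨h1, h2, h3⟩
    have ht : ∀ i, l₀ + c • U (U.symm (c⁻¹ • (t i - l₀))) = t i := by
      simp [hc.ne']
    refine ⟨_, ⟨fun i => (hmem _).1 ?_, by simp [h2], fun i j => (hd _ _).1 ?_⟩, funext ht⟩
    · rw [ht]; exact h1 i
    · rw [ht, ht]; exact h3 i j
  · rintro ⟨s, ⟨h1, h2, h3⟩, rfl⟩
    exact ⟨fun i => (hmem _).2 (h1 i), by simp [f, h2], fun i j => (hd _ _).2 (h3 i j)⟩

theorem covolume_similar {Λ Λ' : Submodule ℤ (Space L)} [DiscreteTopology Λ] [IsZLattice ℝ Λ]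
    {c : ℝ} (hc : 0 < c) (U : Space L ≃ₗᵢ[ℝ] Space L)
    (h : (Λ' : Set (Space L)) = (fun x => c • U x) '' (Λ : Set (Space L))) :
    ZLattice.covolume Λ' = c ^ L * ZLattice.covolume Λ := by
  let e : Space L ≃L[ℝ] Space L :=
    (ContinuousLinearEquiv.smulLeft (R₁ := ℝ) (Units.mk0 c⁻¹ (inv_ne_zero hc.ne'))).trans
      U.symm.toContinuousLinearEquiv
  have he' : ∀ x, e x = U.symm (c⁻¹ • x) := fun x => rfl
  have hcomap : Λ' = ZLattice.comap ℝ Λ e.toLinearMap := by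
    refine SetLike.coe_injective ?_
    rw [h, ZLattice.coe_comap]
    ext x
    constructor
    · rintro ⟨y, hy, rfl⟩
      have : e (c • U y) = y := by rw [he']; simp [hc.ne']
      change e (c • U y) ∈ (Λ : Set (Space L))
      rwa [this]
    · intro hx
      exact ⟨e x, hx, by rw [he']; simp [hc.ne']⟩
  let a : ENNReal := ENNReal.ofReal (c ^ L)
  have ha0 : a ≠ 0 := by simp [a, hc]
  have hat : a ≠ ⊤ := ENNReal.ofReal_ne_top
  have : (a • (volume : Measure (Space L))).IsAddHaarMeasure := .smul _ ha0 hat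
  -- The inverse similarity `e` preserves measure once the target volume is rescaled by `c ^ L`;
  -- that factor passes to the covolume.
  have he : MeasurePreserving e volume (a • (volume : Measure (Space L))) := by
    have h1 : MeasurePreserving (fun x : Space L => c⁻¹ • x) volume
        (a • (volume : Measure (Space L))) := by
      refine ⟨by fun_prop, ?_⟩
      rw [Measure.map_addHaar_smul _ (inv_ne_zero hc.ne'), finrank_euclideanSpace_fin, inv_pow,
        inv_inv, abs_of_pos (pow_pos hc L)]
    exact (U.symm.measurePreserving.smul_measure a).comp h1
  rw [hcomap, ZLattice.covolume_comap Λ (a • volume) volume he,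
    ZLattice.covolume_eq_measure_fundamentalDomain _ _
      (ZLattice.isAddFundamentalDomain (Module.Free.chooseBasis ℤ Λ) _),
    ZLattice.covolume_eq_measure_fundamentalDomain _ _
      (ZLattice.isAddFundamentalDomain (Module.Free.chooseBasis ℤ Λ) _),
    measureReal_ennreal_smul_apply, ENNReal.toReal_ofReal (pow_nonneg hc.le _)]

theorem leastRadius_similar (K : ℕ) [NeZero K] {Λ Λ' : Submodule ℤ (Space L)} {c : ℝ} (hc : 0 < c)
    (U : Space L ≃ₗᵢ[ℝ] Space L)
    (h : (Λ' : Set (Space L)) = (fun x => c • U x) '' (Λ : Set (Space L)))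
    {l₀ : Space L} (hl₀ : l₀ ∈ Λ') (N : ℕ) :
    leastRadius K Λ' l₀ N = c * threshold (numTuples K Λ 0) N := by
  rw [leastRadius, threshold, ← smul_eq_mul, ← Real.sInf_smul_of_nonneg hc.le]
  congr 1
  ext r
  rw [Set.mem_smul_set_iff_inv_smul_mem₀ hc.ne']
  simp only [Set.mem_ofPred_eq, smul_eq_mul, numTuples_similar K hc U h hl₀,
    inv_mul_eq_div, le_div_iff₀ hc, zero_mul]

/-- The scale `c` cancels, leaving a function of `N / ρ ^ (2 * L)` alone, to which limits can be
applied. -/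
theorem expansion_similar (hL : L ≠ 0) {Λ Λ' : Submodule ℤ (Space L)} [DiscreteTopology Λ]
    [IsZLattice ℝ Λ] {c : ℝ} (hc : 0 < c) (U : Space L ≃ₗᵢ[ℝ] Space L)
    (h : (Λ' : Set (Space L)) = (fun x => c • U x) '' (Λ : Set (Space L)))
    (N : ℕ) {ρ : ℝ} (hρ : 0 < ρ) :
    expansion 3 Λ' N (c * ρ) =
      (ZLattice.covolume Λ * ((N : ℝ) / ρ ^ (2 * L)) ^ (1 / 2 : ℝ) / omega L) ^
        (-(1 / (L : ℝ))) := by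
  have hν := ZLattice.covolume_pos Λ volume
  have hω := omega_pos L
  have hN : (0 : ℝ) ≤ N := N.cast_nonneg
  have h2 : (1 / (((3 : ℕ) : ℝ) - 1)) = 1 / 2 := by norm_num
  have hs : (ρ ^ (2 * L)) ^ (1 / 2 : ℝ) = ρ ^ L := by
    rw [← Real.sqrt_eq_rpow, mul_comm, pow_mul, Real.sqrt_sq (by positivity)]
  have hroot : ∀ x : ℝ, 0 < x → (x ^ L) ^ (1 / (L : ℝ)) = x := by
    intro x hx
    rw [one_div, Real.pow_rpow_inv_natCast hx.le hL]
  rw [expansion, lowerRadius, covolume_similar hc U h, h2, Real.div_rpow hN (by positivity), hs,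
    Real.rpow_neg (by positivity), eq_comm, inv_eq_iff_eq_inv, inv_div]
  conv_rhs => rw [← hroot (c * ρ) (by positivity)]
  rw [← Real.div_rpow (by positivity) (by positivity)]
  congr 1
  field_simp
  ring

theorem psi_eq (m : ℕ) {ν : ℝ} (hν : 0 < ν) :
    (ν * (volume.real (unitTriples (2 * m + 1)) / ν ^ 2) ^ (1 / 2 : ℝ) / omega (2 * m + 1)) ^
      (-(1 / ((2 * m + 1 : ℕ) : ℝ))) = psi (2 * m + 1) := by
  have hω := omega_pos (2 * m + 1)
  have hω' := omega_pos (2 * m)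
  have hβ := beta_pos (odd_two_mul_add_one m)
  have hC := volume_unitTriples_pos (2 * m + 1)
  have h1 : ν * (volume.real (unitTriples (2 * m + 1)) / ν ^ 2) ^ (1 / 2 : ℝ) /
      omega (2 * m + 1) =
      (volume.real (unitTriples (2 * m + 1)) / omega (2 * m + 1) ^ 2) ^ (1 / 2 : ℝ) := by
    rw [← Real.sqrt_eq_rpow, ← Real.sqrt_eq_rpow, Real.sqrt_div hC.le, Real.sqrt_div hC.le,
      Real.sqrt_sq hν.le, Real.sqrt_sq hω.le]
    field_simp
  have h2 : (1 / 2 : ℝ) * (-(1 / ((2 * m + 1 : ℕ) : ℝ))) =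
      -(1 / (2 * ((2 * m + 1 : ℕ) : ℝ))) := by
    field_simp
  rw [h1, ← Real.rpow_mul (by positivity), h2, psi, Real.rpow_neg (by positivity),
    Real.rpow_neg hβ.le, ← Real.inv_rpow (by positivity), ← Real.inv_rpow hβ.le,
    ← Real.mul_rpow (by positivity) (by positivity), ← Real.mul_rpow (by positivity) (by positivity),
    volume_unitTriples, Nat.add_sub_cancel]
  congr 1
  push_cast
  field_simp
  ring

theorem tendsto_expansion_similar (hL : Odd L) (Λ : Submodule ℤ (Space L)) [DiscreteTopology Λ]
    [IsZLattice ℝ Λ] {ι : Type*} {l : Filter ι} {Λs : ι → Submodule ℤ (Space L)} {c : ι → ℝ}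
    (hc : ∀ i, 0 < c i) (U : ι → Space L ≃ₗᵢ[ℝ] Space L)
    (h : ∀ i, (Λs i : Set (Space L)) = (fun x => c i • U i x) '' (Λ : Set (Space L)))
    {ρ : ι → ℝ} {N : ι → ℕ} (hρ : Tendsto ρ l atTop)
    (hN : Tendsto (fun i => (N i : ℝ) / ρ i ^ (2 * L)) l
      (𝓝 (volume.real (unitTriples L) / ZLattice.covolume Λ ^ 2))) :
    Tendsto (fun i => expansion 3 (Λs i) (N i) (c i * ρ i)) l (𝓝 (psi L)) := by
  have hν := ZLattice.covolume_pos Λ volume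
  have hω := omega_pos L
  have hC := volume_unitTriples_pos L
  have hlim := (((hN.rpow_const (p := 1 / 2) (Or.inr (by norm_num))).const_mul
    (ZLattice.covolume Λ)).div_const (omega L)).rpow_const (p := -(1 / (L : ℝ)))
    (Or.inl (by positivity))
  have hpsi : (ZLattice.covolume Λ * (volume.real (unitTriples L) / ZLattice.covolume Λ ^ 2) ^
      (1 / 2 : ℝ) / omega L) ^ (-(1 / (L : ℝ))) = psi L := by
    obtain ⟨m, rfl⟩ := hL
    exact psi_eq m hν
  rw [hpsi] at hlim
  refine hlim.congr' ?_
  filter_upwards [hρ.eventually_gt_atTop 0] with i hi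
  rw [expansion_similar hL.pos.ne' (hc i) (U i) (h i) (N i) hi]

end Similarity

/-- Radii are not assumed nonnegative; odd powers are strictly increasing on all of `ℝ`. -/
theorem tendsto_atTop_of_odd_pow {ι : Type*} {l : Filter ι} {L : ℕ} (hL : Odd L) {f : ι → ℝ}
    (hf : Tendsto (fun i => f i ^ L) l atTop) : Tendsto f l atTop := by
  refine tendsto_atTop.2 fun M => ?_
  filter_upwards [hf.eventually_ge_atTop (M ^ L)] with i hi
  exact hL.strictMono_pow.le_iff_le.1 hi

end MDLVQ

/-- The case of 3-tuples and odd `L`. The lattices `Λs i` run through geometrically similar copies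
of one lattice `Λ`, with fundamental volumes `ν_s = covolume (Λs i)`, and `l₀ i` is a point
of `Λs i`.

* If `r^L / ν_s → ∞` (high resolution) and the number of 3-tuples with all pairwise distances
  at most `r` equals `N` in the limit, then the expansion factor `r / r̄` converges to `psi L`.
* If `N → ∞`, then the least radius for which `N` such 3-tuples can be made satisfies
  these requirements, and the resulting expansion factor converges to `psi L`. -/
theorem theorem2 (L : ℕ) (hL : Odd L)
    (Λ : Submodule ℤ (MDLVQ.Space L)) [DiscreteTopology Λ] [IsZLattice ℝ Λ]
    {ι : Type*} (l : Filter ι)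
    (Λs : ι → Submodule ℤ (MDLVQ.Space L))
    (hΛs : ∀ i, MDLVQ.GeomSimilar Λ (Λs i))
    (l₀ : ι → MDLVQ.Space L) (hl₀ : ∀ i, l₀ i ∈ Λs i) :
    0 < MDLVQ.beta L ∧
    (∀ (r : ι → ℝ) (N : ι → ℕ),
      Tendsto (fun i => r i ^ L / ZLattice.covolume (Λs i)) l atTop →
      (fun i => (MDLVQ.numTuples 3 (Λs i) (l₀ i) (r i) : ℝ)) ~[l] (fun i => (N i : ℝ)) →
      Tendsto (fun i => MDLVQ.expansion 3 (Λs i) (N i) (r i)) l (𝓝 (MDLVQ.psi L))) ∧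
    (∀ N : ι → ℕ, Tendsto N l atTop →
      Tendsto (fun i => MDLVQ.leastRadius 3 (Λs i) (l₀ i) (N i) ^ L
        / ZLattice.covolume (Λs i)) l atTop ∧
      (fun i => (MDLVQ.numTuples 3 (Λs i) (l₀ i)
        (MDLVQ.leastRadius 3 (Λs i) (l₀ i) (N i)) : ℝ)) ~[l] (fun i => (N i : ℝ)) ∧
      Tendsto (fun i => MDLVQ.expansion 3 (Λs i) (N i)
        (MDLVQ.leastRadius 3 (Λs i) (l₀ i) (N i))) l (𝓝 (MDLVQ.psi L))) := by
  choose c hc U hU using hΛs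
  have hLpos := hL.pos
  have hν := ZLattice.covolume_pos Λ MeasureTheory.volume
  have hA : 0 < MeasureTheory.volume.real (MDLVQ.unitTriples L) / ZLattice.covolume Λ ^ 2 :=
    div_pos (MDLVQ.volume_unitTriples_pos L) (pow_pos hν 2)
  have hT := MDLVQ.tendsto_numTuples_div_pow hLpos Λ
  have hscale : ∀ i ρ, (c i * ρ) ^ L / ZLattice.covolume (Λs i) = ρ ^ L / ZLattice.covolume Λ := by
    intro i ρ
    have := hc i
    rw [MDLVQ.covolume_similar (hc i) (U i) (hU i)]
    field_simp
    ring
  have hnum : ∀ i ρ, MDLVQ.numTuples 3 (Λs i) (l₀ i) (c i * ρ) = MDLVQ.numTuples 3 Λ 0 ρ := by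
    intro i ρ
    rw [MDLVQ.numTuples_similar 3 (hc i) (U i) (hU i) (hl₀ i),
      mul_div_cancel_left₀ _ (hc i).ne']
  refine ⟨MDLVQ.beta_pos hL, fun r N hr hN => ?_, fun N hN => ?_⟩
  · obtain ⟨ρ, rfl⟩ : ∃ ρ : ι → ℝ, r = fun i => c i * ρ i :=
      ⟨fun i => r i / c i, funext fun i => (mul_div_cancel₀ _ (hc i).ne').symm⟩
    simp only [hscale, hnum] at hr hN
    have hρ : Tendsto ρ l atTop := MDLVQ.tendsto_atTop_of_odd_pow hL
      ((hr.atTop_mul_const hν).congr fun i => div_mul_cancel₀ _ hν.ne')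
    exact MDLVQ.tendsto_expansion_similar hL Λ hc U hU hρ
      ((hN.div .refl).tendsto_nhds (hT.comp hρ))
  · have hk : 2 * L ≠ 0 := by omega
    have hm := MDLVQ.numTuples_mono 3 Λ
    have hR := (MDLVQ.tendsto_threshold hm (MDLVQ.tendsto_atTop_of_div_pow hk hA hT)).comp hN
    have hNR := (MDLVQ.tendsto_div_threshold_pow hm hk hA hT).comp hN
    have hTR := hT.comp hR
    simp only [MDLVQ.leastRadius_similar 3 (hc _) (U _) (hU _) (hl₀ _), hscale, hnum]
    refine ⟨((tendsto_pow_atTop hLpos.ne').comp hR).atTop_div_const hν, ?_,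
      MDLVQ.tendsto_expansion_similar hL Λ hc U hU hR hNR⟩
    -- Both `T(R)` and `N`, divided by `R ^ (2 * L)`, have the same nonzero limit, so `T(R) / N →
    -- 1`.
    have hq := hTR.div hNR hA.ne'
    rw [div_self hA.ne'] at hq
    refine isEquivalent_of_tendsto_one (hq.congr' ?_)
    filter_upwards [hR.eventually_gt_atTop 0] with i hi
    simp only [Function.comp_apply, Pi.div_apply] at hi ⊢
    exact div_div_div_cancel_right₀ (pow_pos hi _).ne' _ _
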